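/- Let $M$ be a proper metric space (every closed ball is compact) with a distinguished point $0\in M$, and let $X$ be a real Banach space with dual $X^*$. Let $Lip(M,X)$ be the space of Lipschitz functions $f:M\to X$ with $f(0)=0$, normed by $\|f\|=\sup_{x\ne y}\frac{\|f(x)-f(y)\|}{d(x,y)}$. Let $$lip(M,X)=\Big\{f\in Lip(M,X):\ \lim_{\varepsilon\to0^+}\ \sup_{0<d(x,y)<\varepsilon}\frac{\|f(x)-f(y)\|}{d(x,y)}=0\Big\},$$ $$S(M,X)=\Big\{f\in lip(M,X):\ \lim_{r\to\infty}\ \sup_{\substack{x\ne y\\ x\notin B(0,r)\text{ or }y\notin B(0,r)}}\frac{\|f(x)-f(y)\|}{d(x,y)}=0\Big\},$$ where $B(0,r)$ is the open ball and a supremum over the empty set is $0$. These are subspaces of $Lip(M,X)$ with the same norm. Write $lip(M)=lip(M,\mathbb R)$ and $S(M)=S(M,\mathbb R)$. For a normed space $Y$, let $K_{w^*,w}(X^*,Y)$ be the space, with the operator norm, of the compact linear operators $X^*\to Y$ that are continuous from the weak-star topology of $X^*$ to the weak topology of $Y$. Then the map $f\mapsto(x^*\mapsto x^*\circ f)$ is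 a linear isometry from $S(M,X)$ onto $K_{w^*,w}(X^*,S(M))$. In particular, if $M$ is compact, the same formula defines a linear isometry from $lip(M,X)$ onto $K_{w^*,w}(X^*,lip(M))$. -/

import Mathlib

set_option maxSynthPendingDepth 3

open Filter Topology
open scoped Pointwise

noncomputable section

section Slopes

variable {M X : Type*} [MetricSpace M] [NormedAddCommGroup X]

/-- The set of slopes `‖f x - f y‖ / d(x, y)`, over the pairs `(x, y) ∈ A` with `x ≠ y`. -/
def slopes (f : M → X) (A : Set (M × M)) : Set ℝ :=
  (fun p : M × M => ‖f p.1 - f p.2‖ / dist p.1 p.2) '' {p | p ∈ A ∧ p.1 ≠ p.2}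

/-- The supremum of the slopes of `f` over the pairs `(x, y) ∈ A` with `x ≠ y`
(with value `0` if there is no such pair). -/
def slopeSup (f : M → X) (A : Set (M × M)) : ℝ := sSup (slopes f A)

theorem slopeSup_nonneg (f : M → X) (A : Set (M × M)) : 0 ≤ slopeSup f A := by
  apply Real.sSup_nonneg
  rintro _ ⟨p, -, rfl⟩
  positivity

theorem bddAbove_slopes {f : M → X} (hf : ∃ K, LipschitzWith K f) (A : Set (M × M)) :
    BddAbove (slopes f A) := by
  obtain ⟨K, hK⟩ := hf
  refine ⟨K, ?_⟩
  rintro _ ⟨p, ⟨-, hp⟩, rfl⟩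
  have h := hK.dist_le_mul p.1 p.2
  rw [dist_eq_norm] at h
  exact (div_le_iff₀ (dist_pos.2 hp)).2 h

theorem slopeSup_add_le {f g : M → X} (hf : ∃ K, LipschitzWith K f) (hg : ∃ K, LipschitzWith K g)
    (A : Set (M × M)) : slopeSup (f + g) A ≤ slopeSup f A + slopeSup g A := by
  apply Real.sSup_le
  · rintro _ ⟨p, hp, rfl⟩
    have h1 : ‖f p.1 - f p.2‖ / dist p.1 p.2 ≤ slopeSup f A :=
      le_csSup (bddAbove_slopes hf A) ⟨p, hp, rfl⟩
    have h2 : ‖g p.1 - g p.2‖ / dist p.1 p.2 ≤ slopeSup g A :=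
      le_csSup (bddAbove_slopes hg A) ⟨p, hp, rfl⟩
    refine le_trans ?_ (add_le_add h1 h2)
    rw [← add_div]
    refine div_le_div_of_nonneg_right ?_ dist_nonneg
    have h3 : (f + g) p.1 - (f + g) p.2 = (f p.1 - f p.2) + (g p.1 - g p.2) := by
      simp only [Pi.add_apply]
      abel
    rw [h3]
    exact norm_add_le _ _
  · exact add_nonneg (slopeSup_nonneg f A) (slopeSup_nonneg g A)

theorem slopeSup_smul [NormedSpace ℝ X] (c : ℝ) (f : M → X) (A : Set (M × M)) :
    slopeSup (c • f) A = |c| * slopeSup f A := by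
  have h : slopes (c • f) A = |c| • slopes f A := by
    unfold slopes
    rw [← Set.image_smul, Set.image_image]
    refine Set.image_congr fun p _ => ?_
    simp only [Pi.smul_apply, ← smul_sub, norm_smul, Real.norm_eq_abs, smul_eq_mul, mul_div_assoc]
  rw [slopeSup, h, Real.sSup_smul_of_nonneg (abs_nonneg c), smul_eq_mul, slopeSup]

theorem slopeSup_zero (A : Set (M × M)) : slopeSup (0 : M → X) A = 0 := by
  refine le_antisymm (Real.sSup_le ?_ le_rfl) (slopeSup_nonneg _ _)
  rintro _ ⟨p, -, rfl⟩
  simp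

end Slopes

section Spaces

variable {M : Type*} [MetricSpace M] (o : M) (X : Type*) [NormedAddCommGroup X] [NormedSpace ℝ X]

/-- The Lipschitz functions `M → X` vanishing at the base point `o`, as a linear space. -/
def lipSubmodule : Submodule ℝ (M → X) where
  carrier := {f | (∃ K, LipschitzWith K f) ∧ f o = 0}
  add_mem' := by
    rintro f g ⟨⟨K, hK⟩, hf⟩ ⟨⟨L, hL⟩, hg⟩
    exact ⟨⟨K + L, hK.add hL⟩, by simp [hf, hg]⟩
  zero_mem' := ⟨⟨0, LipschitzWith.const 0⟩, rfl⟩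
  smul_mem' := by
    rintro c f ⟨⟨K, hK⟩, hf⟩
    refine ⟨⟨‖c‖₊ * K, LipschitzWith.of_dist_le_mul fun x y => ?_⟩, by simp [hf]⟩
    simp only [Pi.smul_apply, NNReal.coe_mul, coe_nnnorm, dist_smul₀, mul_assoc]
    exact mul_le_mul_of_nonneg_left (hK.dist_le_mul x y) (norm_nonneg c)

/-- The space `Lip(M, X)` of Lipschitz functions `M → X` vanishing at the base point `o`.
It is a new type, as its norm is the Lipschitz norm and not a supremum norm. -/
def LipSpace : Type _ := ↥(lipSubmodule o X)

instance : AddCommGroup (LipSpace o X) := inferInstanceAs (AddCommGroup ↥(lipSubmodule o X))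

instance : Module ℝ (LipSpace o X) := inferInstanceAs (Module ℝ ↥(lipSubmodule o X))

instance : CoeFun (LipSpace o X) (fun _ => M → X) := ⟨fun f => f.1⟩

/-- The Lipschitz norm: the supremum of all slopes. -/
instance : Norm (LipSpace o X) := ⟨fun f => slopeSup f Set.univ⟩

theorem LipSpace.normCore : NormedSpace.Core ℝ (LipSpace o X) where
  norm_nonneg f := slopeSup_nonneg _ _
  norm_smul c f := slopeSup_smul c f.1 Set.univ
  norm_triangle f g := slopeSup_add_le f.2.1 g.2.1 Set.univ
  norm_eq_zero_iff f := by
    constructor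
    · intro h
      apply Subtype.ext
      funext x
      by_contra hx
      have hx' : f x ≠ 0 := hx
      have hxo : x ≠ o := fun e => hx' (e ▸ f.2.2)
      have h1 : ‖f x - f o‖ / dist x o ≤ slopeSup f Set.univ :=
        le_csSup (bddAbove_slopes f.2.1 Set.univ) ⟨(x, o), ⟨trivial, hxo⟩, rfl⟩
      have h2 : slopeSup f Set.univ = 0 := h
      have h3 : f o = 0 := f.2.2
      rw [h2, h3, sub_zero] at h1
      exact absurd h1 (not_le.2 (div_pos (norm_pos_iff.2 hx') (dist_pos.2 hxo)))
    · rintro rfl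
      exact slopeSup_zero Set.univ

instance : NormedAddCommGroup (LipSpace o X) := NormedAddCommGroup.ofCore (LipSpace.normCore o X)

instance : NormedSpace ℝ (LipSpace o X) := NormedSpace.ofCore (LipSpace.normCore o X)

/-- The subspace of those `f ∈ Lip(M, X)` whose supremum of slopes over the pairs in `A i`
tends to `0` along the filter `l`. -/
def vanishingSlopes {ι : Type*} (A : ι → Set (M × M)) (l : Filter ι) :
    Submodule ℝ (LipSpace o X) where
  carrier := {f | Tendsto (fun i => slopeSup f (A i)) l (𝓝 0)}
  add_mem' := by
    intro f g hf hg
    have h := Tendsto.add hf hg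
    rw [add_zero] at h
    exact squeeze_zero (fun i => slopeSup_nonneg _ _)
      (fun i => slopeSup_add_le f.2.1 g.2.1 (A i)) h
  zero_mem' := by
    have h : (fun i => slopeSup (0 : LipSpace o X) (A i)) = fun _ => 0 :=
      funext fun i => slopeSup_zero (A i)
    rw [Set.mem_ofPred_eq, h]
    exact tendsto_const_nhds
  smul_mem' := by
    intro c f hf
    have h := Tendsto.const_mul |c| hf
    rw [mul_zero] at h
    exact h.congr fun i => (slopeSup_smul c f.1 (A i)).symm

/-- `lip(M, X)`: the `f ∈ Lip(M, X)` such that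
`sup {‖f x - f y‖ / d(x, y) : 0 < d(x, y) < ε} → 0` as `ε → 0⁺`. -/
def littleLip : Submodule ℝ (LipSpace o X) :=
  vanishingSlopes o X (fun ε : ℝ => {p : M × M | 0 < dist p.1 p.2 ∧ dist p.1 p.2 < ε}) (𝓝[>] 0)

/-- `S(M, X)`: the `f ∈ lip(M, X)` such that
`sup {‖f x - f y‖ / d(x, y) : x ≠ y, x ∉ B(o, r) or y ∉ B(o, r)} → 0` as `r → ∞`. -/
def flatLip : Submodule ℝ (LipSpace o X) :=
  littleLip o X ⊓
    vanishingSlopes o X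
      (fun r : ℝ => {p : M × M | p.1 ∉ Metric.ball o r ∨ p.2 ∉ Metric.ball o r}) atTop

end Spaces

section Operators

variable (X Y : Type*) [NormedAddCommGroup X] [NormedSpace ℝ X] [NormedAddCommGroup Y]
  [NormedSpace ℝ Y]

/-- `K_{w*,w}(X*, Y)`: the compact operators `X* → Y` that are continuous from the weak-star
topology of `X*` to the weak topology of `Y`, with the operator norm. -/
def compactWeakStarWeak : Submodule ℝ (StrongDual ℝ X →L[ℝ] Y) where
  carrier := {T | IsCompactOperator T ∧
    Continuous (fun φ : WeakDual ℝ X => toWeakSpace ℝ Y (T (WeakDual.toStrongDual φ)))}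
  add_mem' := by
    rintro S T ⟨hS, hS'⟩ ⟨hT, hT'⟩
    refine ⟨hS.add hT, ?_⟩
    exact hS'.add hT'
  zero_mem' := by
    refine ⟨isCompactOperator_zero, ?_⟩
    exact continuous_const (y := (0 : WeakSpace ℝ Y))
  smul_mem' := by
    rintro c T ⟨hT, hT'⟩
    refine ⟨hT.smul c, ?_⟩
    exact hT'.const_smul c

end Operators

end

/-! For `f ∈ S(M, X)` the difference quotients of `f` form a totally bounded set `C`: close or
remote pairs give quotients near `0`, and the other pairs lie in a compact set on which the quotient
is continuous. The norm of `φ ∘ f` is the supremum of `|φ|` on `C`, so `φ ↦ φ ∘ f` is bounded on the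
polar of `C`. That bound alone gives compactness (Banach–Alaoglu) and weak-star to weak continuity
(bipolar theorem). Conversely, composing `T` with evaluation at `m` gives a weak-star continuous
functional, hence a point `f m` of `X`. Compactness of `T` makes the slopes of `T φ` vanish
uniformly over `‖φ‖ ≤ 1`, and norming functionals pass this to `f`. They also give the isometry. -/

noncomputable section

/-! ### Operators on a dual space bounded on the polar of a totally bounded set -/

section DualOfDual

variable {X Y : Type*} [NormedAddCommGroup X] [NormedSpace ℝ X] [NormedAddCommGroup Y]
  [NormedSpace ℝ Y]

/-- A linear functional on `X*` which is bounded on the polar of a totally bounded subset of the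
Banach space `X` is the evaluation at a point of `X`. -/
theorem exists_eq_eval_of_bounded_on_polar [CompleteSpace X] {C : Set X} (hC : TotallyBounded C)
    (h0 : (0 : X) ∈ C) {a : ℝ} (ha : 0 < a) (L : StrongDual ℝ (StrongDual ℝ X))
    (hL : ∀ φ : StrongDual ℝ X, (∀ k ∈ C, |φ k| ≤ 1) → |L φ| ≤ a) :
    ∃ x : X, ∀ φ : StrongDual ℝ X, L φ = φ x := by
  set D : Set X := closedAbsConvexHull ℝ C with hD
  have hDc : IsCompact D := isCompact_closedAbsConvexHull_of_totallyBounded hC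
  have hCD : C ⊆ D := subset_closedAbsConvexHull
  have hDabs : AbsConvex ℝ D := absConvex_convexClosedHull
  let J : X →ₗ[ℝ] WeakDual ℝ (StrongDual ℝ X) :=
    StrongDual.toWeakDual.toLinearMap ∘ₗ
      (NormedSpace.inclusionInDoubleDual ℝ X).toLinearMap
  have hJ : ∀ x φ, J x φ = φ x := fun x φ => rfl
  have hJc : Continuous J := WeakDual.continuous_of_continuous_eval fun φ => φ.continuous
  have hJD : IsCompact (J '' D) := hDc.image hJc
  have : LocallyConvexSpace ℝ (WeakDual ℝ (StrongDual ℝ X)) :=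
    inferInstanceAs (LocallyConvexSpace ℝ (WeakBilin (topDualPairing ℝ (StrongDual ℝ X))))
  -- Bipolar argument: a weak-star continuous functional on `X**` is evaluation at some `φ`.
  -- Separation would give `φ < u` on `D` and `a * u < L φ`, but `u⁻¹ • φ` lies in the polar of `C`.
  have key : StrongDual.toWeakDual (a⁻¹ • L) ∈ J '' D := by
    by_contra hmem
    obtain ⟨F, u, hFu, huF⟩ := geometric_hahn_banach_closed_point
      (hDabs.2.linear_image J) hJD.isClosed hmem
    obtain ⟨φ, rfl⟩ := LinearMap.dualEmbedding_surjective (topDualPairing ℝ (StrongDual ℝ X)) F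
    have h1 : ∀ c ∈ D, φ c < u := fun c hc => hFu (J c) ⟨c, hc, rfl⟩
    have h2 : u < a⁻¹ * L φ := huF
    have hu : 0 < u := by simpa using h1 0 (hCD h0)
    have h3 : |L (u⁻¹ • φ)| ≤ a := by
      refine hL _ fun k hk => ?_
      have hp := h1 k (hCD hk)
      have hn := h1 (-k) (hDabs.1.neg_mem_iff.2 (hCD hk))
      rw [map_neg] at hn
      have : |φ k| ≤ u := abs_le.2 ⟨by linarith, hp.le⟩
      simpa [abs_mul, abs_of_pos hu, inv_mul_le_iff₀ hu] using this
    have h4 : L φ ≤ u * a := by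
      have := (le_abs_self _).trans h3
      simpa [inv_mul_le_iff₀ hu] using this
    rw [lt_inv_mul_iff₀ ha] at h2
    linarith [mul_comm a u]
  obtain ⟨x, -, hx⟩ := key
  refine ⟨a • x, fun φ => ?_⟩
  have h : φ x = a⁻¹ * L φ := congrArg (fun F : WeakDual ℝ (StrongDual ℝ X) => F φ) hx
  rw [map_smul, h, smul_eq_mul, mul_inv_cancel_left₀ ha.ne']

/-- An operator from `X*` which is bounded on the polar of a totally bounded set is weak-star to
norm continuous on the closed unit ball. -/
theorem continuousOn_closedBall_of_bounded_on_polar {C : Set X} (hC : TotallyBounded C)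
    (T : StrongDual ℝ X →L[ℝ] Y)
    (hT : ∀ φ : StrongDual ℝ X, (∀ k ∈ C, |φ k| ≤ 1) → ‖T φ‖ ≤ 1) :
    ContinuousOn (fun φ : WeakDual ℝ X => T (WeakDual.toStrongDual φ))
      (WeakDual.toStrongDual ⁻¹' Metric.closedBall 0 1) := by
  have hT' : ∀ (φ : StrongDual ℝ X) (s : ℝ), 0 < s → (∀ k ∈ C, |φ k| ≤ s) → ‖T φ‖ ≤ s := by
    intro φ s hs h
    have := hT (s⁻¹ • φ) fun k hk => by
      simpa [abs_mul, abs_of_pos hs, inv_mul_le_iff₀ hs] using h k hk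
    simpa [norm_smul, abs_of_pos hs, inv_mul_le_iff₀ hs] using this
  intro φ₀ hφ₀
  rw [ContinuousWithinAt, Metric.tendsto_nhds]
  intro ε hε
  -- On `C`, the difference of two functionals in the unit ball is at most `2 * (ε / 8)`, from the
  -- distance to the net, plus `ε / 8` at a net point.
  obtain ⟨t, ht, hCt⟩ := Metric.totallyBounded_iff.1 hC (ε / 8) (by positivity)
  have hev : ∀ᶠ φ : WeakDual ℝ X in 𝓝 φ₀, ∀ k ∈ t, dist (φ k) (φ₀ k) < ε / 8 :=
    (eventually_all_finite ht).2 fun k _ =>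
      Metric.tendsto_nhds.1 (WeakDual.eval_continuous k).continuousAt (ε / 8) (by positivity)
  filter_upwards [nhdsWithin_le_nhds hev, self_mem_nhdsWithin] with φ hφt hφ
  set χ : StrongDual ℝ X := WeakDual.toStrongDual φ - WeakDual.toStrongDual φ₀ with hχ
  have hχn : ‖χ‖ ≤ 2 := by
    have h1 : ‖WeakDual.toStrongDual φ‖ ≤ 1 := mem_closedBall_zero_iff.1 hφ
    have h2 : ‖WeakDual.toStrongDual φ₀‖ ≤ 1 := mem_closedBall_zero_iff.1 hφ₀
    linarith [norm_sub_le (WeakDual.toStrongDual φ) (WeakDual.toStrongDual φ₀)]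
  rw [dist_eq_norm, ← map_sub]
  refine (hT' χ (3 * (ε / 8)) (by positivity) fun k hk => ?_).trans_lt (by linarith)
  obtain ⟨y, hy, hky⟩ := Set.mem_iUnion₂.1 (hCt hk)
  have h1 : |χ y| < ε / 8 := hφt y hy
  have h2 : |χ (k - y)| ≤ 2 * (ε / 8) := by
    refine (χ.le_opNorm (k - y)).trans ?_
    have : ‖k - y‖ ≤ ε / 8 := (mem_ball_iff_norm.1 hky).le
    gcongr
  have h3 : χ k = χ (k - y) + χ y := by rw [map_sub]; ring
  rw [h3]
  linarith [abs_add_le (χ (k - y)) (χ y)]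

/-- An operator from the dual of a Banach space which is bounded on the polar of a totally bounded
set is compact and weak-star to weak continuous. -/
theorem mem_compactWeakStarWeak_of_bounded_on_polar [CompleteSpace X] {C : Set X}
    (hC : TotallyBounded C) (h0 : (0 : X) ∈ C) (T : StrongDual ℝ X →L[ℝ] Y)
    (hT : ∀ φ : StrongDual ℝ X, (∀ k ∈ C, |φ k| ≤ 1) → ‖T φ‖ ≤ 1) :
    T ∈ compactWeakStarWeak X Y := by
  constructor
  · refine (isCompactOperator_iff_image_closedBall_subset_compact
      (T : StrongDual ℝ X →ₗ[ℝ] Y) one_pos).2 ⟨_, (WeakDual.isCompact_closedBall 0 1).image_of_continuousOn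
      (continuousOn_closedBall_of_bounded_on_polar hC T hT), ?_⟩
    rintro _ ⟨φ, hφ, rfl⟩
    exact ⟨StrongDual.toWeakDual φ, hφ, rfl⟩
  · refine WeakBilin.continuous_of_continuous_eval _ fun ψ => ?_
    -- The `+ 1` keeps the bound positive when `ψ = 0`.
    obtain ⟨x, hx⟩ := exists_eq_eval_of_bounded_on_polar hC h0
      (a := ‖ψ‖ + 1) (by positivity) (ψ.comp T) fun φ hφ => by
        have h1 : ‖ψ (T φ)‖ ≤ ‖ψ‖ * ‖T φ‖ := ψ.le_opNorm _
        have h2 := mul_le_mul_of_nonneg_left (hT φ hφ) (norm_nonneg ψ)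
        have h3 : |ψ (T φ)| ≤ ‖ψ‖ + 1 := by rw [← Real.norm_eq_abs]; linarith
        exact h3
    have : (fun φ : WeakDual ℝ X => ψ (T (WeakDual.toStrongDual φ))) = fun φ => φ x :=
      funext fun φ => hx (WeakDual.toStrongDual φ)
    exact this ▸ WeakDual.eval_continuous x

/-- A weak-star to weak continuous operator composed with a functional is an evaluation. -/
theorem exists_eq_eval_of_mem_compactWeakStarWeak {T : StrongDual ℝ X →L[ℝ] Y}
    (hT : T ∈ compactWeakStarWeak X Y) (ψ : StrongDual ℝ Y) :
    ∃ x : X, ∀ φ : StrongDual ℝ X, ψ (T φ) = φ x := by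
  have hc : Continuous fun φ : WeakDual ℝ X => ψ (T (WeakDual.toStrongDual φ)) :=
    (WeakBilin.eval_continuous (topDualPairing ℝ Y).flip ψ).comp hT.2
  let F : StrongDual ℝ (WeakDual ℝ X) :=
    ⟨ψ.toLinearMap ∘ₗ T.toLinearMap ∘ₗ WeakDual.toStrongDual.toLinearMap, hc⟩
  obtain ⟨x, hx⟩ := LinearMap.dualEmbedding_surjective (topDualPairing ℝ X) F
  exact ⟨x, fun φ => (congrArg
    (fun G : StrongDual ℝ (WeakDual ℝ X) => G (StrongDual.toWeakDual φ)) hx).symm⟩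

end DualOfDual

section Slopes

variable {M X : Type*} [MetricSpace M] [NormedAddCommGroup X]

theorem norm_sub_le_slopeSup {f : M → X} (hf : ∃ K, LipschitzWith K f) {A : Set (M × M)} {x y : M}
    (hxy : (x, y) ∈ A) : ‖f x - f y‖ ≤ slopeSup f A * dist x y := by
  rcases eq_or_ne x y with rfl | hne
  · simp
  · rw [← div_le_iff₀ (dist_pos.2 hne)]
    exact le_csSup (bddAbove_slopes hf A) ⟨(x, y), ⟨hxy, hne⟩, rfl⟩

theorem slopeSup_le {f : M → X} {A : Set (M × M)} {c : ℝ} (hc : 0 ≤ c)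
    (h : ∀ x y, (x, y) ∈ A → ‖f x - f y‖ ≤ c * dist x y) : slopeSup f A ≤ c := by
  refine Real.sSup_le ?_ hc
  rintro _ ⟨p, ⟨hp, hne⟩, rfl⟩
  exact (div_le_iff₀ (dist_pos.2 hne)).2 (h _ _ hp)

end Slopes

/-! ### Vector-valued Lipschitz functions and the operators they induce -/

section LipSpace

variable {M : Type*} [MetricSpace M] {o : M} {X : Type*} [NormedAddCommGroup X] [NormedSpace ℝ X]

theorem LipSpace.norm_sub_le (f : LipSpace o X) (x y : M) : ‖f x - f y‖ ≤ ‖f‖ * dist x y :=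
  norm_sub_le_slopeSup f.2.1 (Set.mem_univ _)

theorem LipSpace.norm_le {f : LipSpace o X} {c : ℝ} (hc : 0 ≤ c)
    (h : ∀ x y, ‖f x - f y‖ ≤ c * dist x y) : ‖f‖ ≤ c :=
  slopeSup_le hc fun x y _ => h x y

theorem LipSpace.ext {f g : LipSpace o X} (h : ∀ m, f m = g m) : f = g :=
  Subtype.ext (funext h)

/-- Evaluation at a point, as a functional on `Lip(M)`. -/
def LipSpace.evalCLM (m : M) : LipSpace o ℝ →L[ℝ] ℝ :=
  LinearMap.mkContinuous
    { toFun := fun f => f m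
      map_add' := fun _ _ => rfl
      map_smul' := fun _ _ => rfl } (dist m o) fun f => by
    have h := f.norm_sub_le m o
    have h0 : f o = 0 := f.2.2
    rw [h0, sub_zero, mul_comm] at h
    exact h

/-- The function `φ ∘ f` in `Lip(M)`. -/
def LipSpace.comp (φ : StrongDual ℝ X) (f : LipSpace o X) : LipSpace o ℝ :=
  ⟨fun m => φ (f m), by
    obtain ⟨K, hK⟩ := f.2.1
    exact ⟨⟨_, φ.lipschitz.comp hK⟩, by simp [show f.1 o = 0 from f.2.2]⟩⟩

theorem LipSpace.slopeSup_comp_le (φ : StrongDual ℝ X) (f : LipSpace o X) (A : Set (M × M)) :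
    slopeSup (LipSpace.comp φ f) A ≤ ‖φ‖ * slopeSup f A := by
  refine slopeSup_le (mul_nonneg (norm_nonneg _) (slopeSup_nonneg _ _)) fun x y hxy => ?_
  have h1 : ‖φ (f x) - φ (f y)‖ ≤ ‖φ‖ * ‖f x - f y‖ := by
    rw [← map_sub]
    exact φ.le_opNorm _
  refine h1.trans ?_
  rw [mul_assoc]
  exact mul_le_mul_of_nonneg_left (norm_sub_le_slopeSup f.2.1 hxy) (norm_nonneg _)

theorem LipSpace.comp_mem_vanishingSlopes (φ : StrongDual ℝ X) {f : LipSpace o X} {ι : Type*}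
    {A : ι → Set (M × M)} {l : Filter ι} (hf : f ∈ vanishingSlopes o X A l) :
    LipSpace.comp φ f ∈ vanishingSlopes o ℝ A l := by
  have h := Tendsto.const_mul ‖φ‖ hf
  rw [mul_zero] at h
  exact squeeze_zero (fun i => slopeSup_nonneg _ _) (fun i => LipSpace.slopeSup_comp_le φ f (A i)) h

theorem LipSpace.comp_mem_flatLip (φ : StrongDual ℝ X) {f : LipSpace o X} (hf : f ∈ flatLip o X) :
    LipSpace.comp φ f ∈ flatLip o ℝ :=
  ⟨LipSpace.comp_mem_vanishingSlopes φ hf.1, LipSpace.comp_mem_vanishingSlopes φ hf.2⟩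

/-- The set of difference quotients of a function. -/
def slopeVectors (f : M → X) : Set X :=
  Set.range fun p : M × M => (dist p.1 p.2)⁻¹ • (f p.1 - f p.2)

/-- Diagonal pairs contribute `0`; the base point only supplies such a pair. -/
theorem zero_mem_slopeVectors (o : M) (f : M → X) : (0 : X) ∈ slopeVectors f :=
  ⟨(o, o), by simp⟩

theorem LipSpace.norm_comp_le {φ : StrongDual ℝ X} {f : LipSpace o X} {c : ℝ} (hc : 0 ≤ c)
    (h : ∀ k ∈ slopeVectors f, |φ k| ≤ c) : ‖LipSpace.comp φ f‖ ≤ c := by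
  refine LipSpace.norm_le hc fun x y => ?_
  rcases eq_or_ne x y with rfl | hne
  · simp
  have h1 := h _ ⟨(x, y), rfl⟩
  have hd := dist_pos.2 hne
  rw [map_smul, smul_eq_mul, abs_mul, abs_of_pos (inv_pos.2 hd), inv_mul_le_iff₀ hd, map_sub,
    mul_comm] at h1
  exact h1

theorem totallyBounded_slopeVectors [ProperSpace M] {f : LipSpace o X} (hf : f ∈ flatLip o X) :
    TotallyBounded (slopeVectors f) := by
  refine Metric.totallyBounded_iff.2 fun ε hε => ?_
  obtain ⟨δ, hδ, hδpos⟩ := ((hf.1.eventually_lt_const hε).and self_mem_nhdsWithin).exists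
  obtain ⟨r, hr⟩ := (hf.2.eventually_lt_const hε).exists
  have hδpos : 0 < δ := hδpos
  let Q : Set (M × M) :=
    (Metric.closedBall o r ×ˢ Metric.closedBall o r) ∩ {p | δ ≤ dist p.1 p.2}
  have hQ : IsCompact Q :=
    ((isCompact_closedBall o r).prod (isCompact_closedBall o r)).inter_right
      (isClosed_le continuous_const continuous_dist)
  have hfc : Continuous f.1 := f.2.1.choose_spec.continuous
  have hcont : ContinuousOn (fun p : M × M => (dist p.1 p.2)⁻¹ • (f p.1 - f p.2)) Q := by
    refine ContinuousOn.smul (continuous_dist.continuousOn.inv₀ fun p hp => ?_)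
      ((hfc.comp continuous_fst).sub (hfc.comp continuous_snd)).continuousOn
    exact (hδpos.trans_le hp.2).ne'
  obtain ⟨t, ht, hQt⟩ := Metric.totallyBounded_iff.1 (hQ.image_of_continuousOn hcont).totallyBounded ε hε
  -- The extra centre `0` covers the quotients of close, remote and diagonal pairs.
  refine ⟨insert 0 t, ht.insert 0, ?_⟩
  rintro _ ⟨⟨x, y⟩, rfl⟩
  have small : ∀ A : Set (M × M), slopeSup f A < ε → (x, y) ∈ A →
      (dist x y)⁻¹ • (f x - f y) ∈ ⋃ z ∈ insert 0 t, Metric.ball z ε := by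
    intro A hA hxy
    refine Set.mem_iUnion₂.2 ⟨0, Set.mem_insert _ _, ?_⟩
    rw [mem_ball_zero_iff, norm_smul, norm_inv, Real.norm_of_nonneg dist_nonneg]
    rcases eq_or_ne x y with rfl | hne
    · simpa using hε
    · rw [inv_mul_lt_iff₀ (dist_pos.2 hne), mul_comm]
      exact (norm_sub_le_slopeSup f.2.1 hxy).trans_lt
        (mul_lt_mul_of_pos_right hA (dist_pos.2 hne))
  by_cases h1 : (x, y) ∈ {p : M × M | p.1 ∉ Metric.ball o r ∨ p.2 ∉ Metric.ball o r}
  · exact small _ hr h1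
  rcases eq_or_ne x y with rfl | hne
  · exact Set.mem_iUnion₂.2 ⟨0, Set.mem_insert _ _, by simpa using hε⟩
  by_cases h2 : dist x y < δ
  · exact small _ hδ ⟨dist_pos.2 hne, h2⟩
  have h1' : x ∈ Metric.ball o r ∧ y ∈ Metric.ball o r := by
    simpa [not_or, not_not] using h1
  have hmem := hQt ⟨(x, y), ⟨⟨Metric.ball_subset_closedBall h1'.1,
    Metric.ball_subset_closedBall h1'.2⟩, not_lt.1 h2⟩, rfl⟩
  obtain ⟨z, hz, hxz⟩ := Set.mem_iUnion₂.1 hmem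
  exact Set.mem_iUnion₂.2 ⟨z, Set.mem_insert_of_mem _ hz, hxz⟩

/-- For `f ∈ S(M, X)`, the operator `φ ↦ φ ∘ f` from `X*` to `S(M)`. -/
def flatLipOperator (f : flatLip o X) : StrongDual ℝ X →L[ℝ] flatLip o ℝ :=
  LinearMap.mkContinuous
    { toFun := fun φ => ⟨LipSpace.comp φ f.1, LipSpace.comp_mem_flatLip φ f.2⟩
      map_add' := fun _ _ => rfl
      map_smul' := fun _ _ => rfl } ‖f‖ fun φ => by
    rw [mul_comm]
    exact LipSpace.slopeSup_comp_le φ f.1 Set.univ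

/-- The lower bound is Hahn–Banach: `‖f x - f y‖` is determined by the values `φ (f x - f y)`. -/
theorem norm_flatLipOperator (f : flatLip o X) : ‖flatLipOperator f‖ = ‖f‖ := by
  refine le_antisymm (LinearMap.mkContinuous_norm_le _ (norm_nonneg _) _) ?_
  refine LipSpace.norm_le (norm_nonneg _) fun x y => ?_
  refine NormedSpace.norm_le_dual_bound ℝ _ (by positivity) fun φ => ?_
  have h1 := (flatLipOperator f φ).1.norm_sub_le x y
  have h2 : ‖(flatLipOperator f φ).1‖ ≤ ‖flatLipOperator f‖ * ‖φ‖ := (flatLipOperator f).le_opNorm φ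
  rw [map_sub]
  refine h1.trans ((mul_le_mul_of_nonneg_right h2 dist_nonneg).trans_eq ?_)
  ring

theorem flatLipOperator_mem [ProperSpace M] [CompleteSpace X] (f : flatLip o X) :
    flatLipOperator f ∈ compactWeakStarWeak X (flatLip o ℝ) :=
  mem_compactWeakStarWeak_of_bounded_on_polar (totallyBounded_slopeVectors f.2)
    (zero_mem_slopeVectors o _) _ fun _ hφ => LipSpace.norm_comp_le zero_le_one hφ

/-- An operator in `K_{w*,w}(X*, V)`, for `V` a subspace of `Lip(M)`, is represented by a function
in `Lip(M, X)`. -/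
theorem exists_lipSpace_of_mem_compactWeakStarWeak {V : Submodule ℝ (LipSpace o ℝ)}
    {T : StrongDual ℝ X →L[ℝ] V} (hT : T ∈ compactWeakStarWeak X V) :
    ∃ f : LipSpace o X, ∀ φ m, (T φ).1 m = φ (f m) := by
  have h : ∀ m : M, ∃ x : X, ∀ φ : StrongDual ℝ X, (T φ).1 m = φ x := fun m =>
    exists_eq_eval_of_mem_compactWeakStarWeak hT ((LipSpace.evalCLM m).comp V.subtypeL)
  choose f hf using h
  refine ⟨⟨f, ⟨‖T‖₊, LipschitzWith.of_dist_le_mul fun x y => ?_⟩, ?_⟩, fun φ m => hf m φ⟩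
  · rw [dist_eq_norm]
    refine NormedSpace.norm_le_dual_bound ℝ _ (by positivity) fun φ => ?_
    have h1 := (T φ).1.norm_sub_le x y
    have h2 : ‖(T φ).1‖ ≤ ‖T‖ * ‖φ‖ := T.le_opNorm φ
    rw [map_sub, ← hf, ← hf]
    refine h1.trans ((mul_le_mul_of_nonneg_right h2 dist_nonneg).trans_eq ?_)
    rw [coe_nnnorm]
    ring
  · refine SeparatingDual.eq_zero_of_forall_dual_eq_zero (R := ℝ) fun φ => ?_
    rw [← hf]
    exact (T φ).1.2.2

/-- If the functions representing `T` have uniformly vanishing slopes, so has the function in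
`Lip(M, X)` representing the compact operator `T`. -/
theorem mem_vanishingSlopes_of_isCompactOperator {V : Submodule ℝ (LipSpace o ℝ)}
    {T : StrongDual ℝ X →L[ℝ] V} (hT : IsCompactOperator T) {f : LipSpace o X}
    (hf : ∀ φ m, (T φ).1 m = φ (f m)) {ι : Type*} {A : ι → Set (M × M)} {l : Filter ι}
    (hV : V ≤ vanishingSlopes o ℝ A l) : f ∈ vanishingSlopes o X A l := by
  obtain ⟨K, hK, hTK⟩ := IsCompactOperator.image_closedBall_subset_compact
    (f := (T : StrongDual ℝ X →ₗ[ℝ] V)) hT 1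
  refine Metric.tendsto_nhds.2 fun ε hε => ?_
  -- Each `T φ` with `‖φ‖ ≤ 1` is within `ε / 4` of a net point, whose slopes are eventually below
  -- `ε / 4`; finiteness of the net makes this uniform in `φ`.
  obtain ⟨t, ht, hKt⟩ := Metric.totallyBounded_iff.1 hK.totallyBounded (ε / 4) (by positivity)
  have hev : ∀ᶠ i in l, ∀ g ∈ t, slopeSup g.1 (A i) < ε / 4 :=
    (eventually_all_finite ht).2 fun g _ =>
      Tendsto.eventually_lt_const (by positivity) (hV g.2)
  filter_upwards [hev] with i hi
  rw [Real.dist_eq, sub_zero, abs_of_nonneg (slopeSup_nonneg _ _)]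
  refine (slopeSup_le (c := ε / 2) (by positivity) fun x y hxy => ?_).trans_lt (by linarith)
  -- The norming functional depends on the pair, hence the need for uniformity in `φ`.
  obtain ⟨φ, hφ, hφx⟩ := exists_dual_vector'' ℝ (f x - f y)
  obtain ⟨g, hg, hφg⟩ := Set.mem_iUnion₂.1
    (hKt (hTK ⟨φ, mem_closedBall_zero_iff.2 hφ, rfl⟩))
  have h1 : ‖(T φ - g).1‖ < ε / 4 := mem_ball_iff_norm.1 hφg
  have h2 := (T φ - g).1.norm_sub_le x y
  have h3 := (norm_sub_le_slopeSup g.1.2.1 hxy).trans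
    (mul_le_mul_of_nonneg_right (hi g hg).le dist_nonneg)
  have h4 : ((T φ).1 x - (T φ).1 y) =
      ((T φ - g).1 x - (T φ - g).1 y) + (g.1 x - g.1 y) := by
    have e : ∀ m, (T φ - g).1 m = (T φ).1 m - g.1 m := fun m => rfl
    rw [e, e]
    ring
  have h5 : ‖f x - f y‖ = (T φ).1 x - (T φ).1 y := by
    rw [hf, hf, ← map_sub]
    exact hφx.symm
  rw [h5, h4]
  have h6 := mul_le_mul_of_nonneg_right h1.le (dist_nonneg (x := x) (y := y))
  refine (le_abs_self _).trans ((abs_add_le _ _).trans ?_)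
  rw [← Real.norm_eq_abs, ← Real.norm_eq_abs]
  linarith

variable (o X) in
/-- The isometry `f ↦ (φ ↦ φ ∘ f)` from `S(M, X)` onto `K_{w*,w}(X*, S(M))`. -/
def flatLipEquiv [ProperSpace M] [CompleteSpace X] :
    flatLip o X ≃ₗᵢ[ℝ] compactWeakStarWeak X (flatLip o ℝ) :=
  LinearIsometryEquiv.ofSurjective
    { toFun := fun f => ⟨flatLipOperator f, flatLipOperator_mem f⟩
      map_add' := fun f g => Subtype.ext <| ContinuousLinearMap.ext fun φ => Subtype.ext <|
        LipSpace.ext fun m => map_add φ (f.1 m) (g.1 m)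
      map_smul' := fun c f => Subtype.ext <| ContinuousLinearMap.ext fun φ => Subtype.ext <|
        LipSpace.ext fun m => map_smul φ c (f.1 m)
      norm_map' := norm_flatLipOperator } <| by
    rintro ⟨T, hT⟩
    obtain ⟨f, hf⟩ := exists_lipSpace_of_mem_compactWeakStarWeak hT
    have hmem : f ∈ flatLip o X :=
      ⟨mem_vanishingSlopes_of_isCompactOperator hT.1 hf inf_le_left,
        mem_vanishingSlopes_of_isCompactOperator hT.1 hf inf_le_right⟩
    exact ⟨⟨f, hmem⟩, Subtype.ext <| ContinuousLinearMap.ext fun φ => Subtype.ext <|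
      LipSpace.ext fun m => (hf φ m).symm⟩

variable (o X) in
-- For large `r` the ball is all of `M`, so the supremum at infinity runs over no pair and is `0`.
theorem flatLip_eq_littleLip [CompactSpace M] : flatLip o X = littleLip o X := by
  refine inf_eq_left.2 fun f _ => ?_
  obtain ⟨R, hR⟩ := (isCompact_univ (X := M)).isBounded.subset_ball o
  refine tendsto_const_nhds.congr' ?_
  filter_upwards [eventually_ge_atTop R] with r hr
  refine le_antisymm (slopeSup_nonneg _ _) (slopeSup_le le_rfl fun x y hxy => ?_)
  have h : ∀ z : M, z ∈ Metric.ball o r := fun z => Metric.ball_subset_ball hr (hR trivial)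
  rcases hxy with hx | hy
  · exact absurd (h x) hx
  · exact absurd (h y) hy

end LipSpace

end

theorem mainTheorem3 {M : Type*} [MetricSpace M] [ProperSpace M] (o : M)
    {X : Type*} [NormedAddCommGroup X] [NormedSpace ℝ X] [CompleteSpace X] :
    (∃ Φ : flatLip o X ≃ₗᵢ[ℝ] compactWeakStarWeak X (flatLip o ℝ),
      ∀ (f : flatLip o X) (φ : StrongDual ℝ X) (m : M),
        ((Φ f).1 φ).1 m = φ (f.1 m)) ∧
    (CompactSpace M →
      ∃ Φ : littleLip o X ≃ₗᵢ[ℝ] compactWeakStarWeak X (littleLip o ℝ),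
        ∀ (f : littleLip o X) (φ : StrongDual ℝ X) (m : M),
          ((Φ f).1 φ).1 m = φ (f.1 m)) := by
  refine ⟨⟨flatLipEquiv o X, fun _ _ _ => rfl⟩, fun _ => ?_⟩
  rw [← flatLip_eq_littleLip o X, ← flatLip_eq_littleLip o ℝ]
  exact ⟨flatLipEquiv o X, fun _ _ _ => rfl⟩
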